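/- Let $K$ be a field. A Brauer configuration $\Gamma=(\Gamma_0,\Gamma_1,\mu,\mathfrak o)$ consists of a finite set $\Gamma_0$ of vertices, a finite collection $\Gamma_1$ of labelled finite multisets of vertices (called polygons), a function $\mu\colon\Gamma_0\to\mathbb Z_{>0}$, and, for each $\alpha\in\Gamma_0$, a cyclic ordering of the list of polygons containing $\alpha$, in which each polygon $V$ is listed $\operatorname{occ}(\alpha,V)$ times ($\operatorname{occ}(\alpha,V)$ is the multiplicity of $\alpha$ in $V$). With $\operatorname{val}(\alpha)=\sum_{V\in\Gamma_1}\operatorname{occ}(\alpha,V)$ it is required that every vertex lies in some polygon, that every polygon has at least two vertices counted with multiplicity, and that every polygon contains a vertex $\alpha$ with $\operatorname{val}(\alpha)\mu(\alpha)>1$. A vertex $\alpha$ is truncated if $\operatorname{val}(\alpha)\mu(\alpha)=1$. The quiver $\mathcal Q_\Gamma$ has one vertex $v$ for each polygon $V\in\Gamma_1$. For each nontruncated $\alpha$ with cyclic ordering $V_1<\dots<V_n<V_1$, $n=\operatorname{val}(\alpha)$, it has arrows $a_r\colon v_r\to v_{r+1}$ for $1\le r\le n$ (where $v_{n+1}=v_1$),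 and these are all its arrows. Paths are written from left to right. The cycles $C_j=a_ja_{j+1}\cdots a_na_1\cdots a_{j-1}$, $1\le j\le n$, are the special $\alpha$-cycles; $C_j$ is a special $\alpha$-cycle at $v_j$. Let $I_\Gamma$ be the two-sided ideal of the path algebra $K\mathcal Q_\Gamma$ generated by 1. all $C^{\mu(\alpha)}-C'^{\mu(\beta)}$, where $C$ is a special $\alpha$-cycle and $C'$ is a special $\beta$-cycle at the same vertex of $\mathcal Q_\Gamma$ ($\alpha,\beta$ nontruncated, $\alpha=\beta$ allowed); 2. all $C^{\mu(\alpha)}a$, where $C$ is a special $\alpha$-cycle and $a$ is the first arrow of $C$; 3. all paths $ab$ of length two that are not a subpath of any special cycle, except those with $a=b$ a loop associated to a vertex $\alpha$ with $\operatorname{val}(\alpha)=1$ and $\mu(\alpha)>1$. Put $\Lambda_\Gamma=K\mathcal Q_\Gamma/I_\Gamma$, and let $J$ be the two-sided ideal of $K\mathcal Q_\Gamma$ generated by the arrows. **Proposition.** For every Brauer configuration $\Gamma$ the ideal $I_\Gamma$ is admissible, that is, $J^N\subseteq I_\Gamma\subseteq J^2$ for some $N\ge2$; in particular $\Lambda_\Gamma$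 is finite dimensional over $K$. Moreover $\Lambda_\Gamma$ is a symmetric algebra, and the following form shows this: there is a $K$-linear form $\varphi\colon\Lambda_\Gamma\to K$ such that, for every path $p$ of $\mathcal Q_\Gamma$, $\varphi(\bar p)=1$ if $p=C^{\mu(\alpha)}$ for some nontruncated vertex $\alpha$ and some special $\alpha$-cycle $C$, and $\varphi(\bar p)=0$ otherwise; it satisfies $\varphi(xy)=\varphi(yx)$ for all $x,y\in\Lambda_\Gamma$, and $\ker\varphi$ contains no nonzero left ideal and no nonzero right ideal of $\Lambda_\Gamma$. -/

import Mathlib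

/-! ### Path algebras -/

section PathAlgebra

/-- A path of a quiver together with its source and its target. -/
abbrev Quiver.AnyPath (V : Type*) [Quiver V] := Σ a b : V, Quiver.Path a b

/-- The underlying vector space of the path algebra `KQ` (the quiver `Q` being given by its vertex
type `V`): it has the set of all paths of `Q` as a basis. -/
def PathAlgebra (K : Type*) [Field K] (V : Type*) [Quiver V] := Quiver.AnyPath V →₀ K

namespace PathAlgebra

variable {K : Type*} [Field K] {V : Type*} [Quiver V]

noncomputable instance : AddCommGroup (PathAlgebra K V) :=
  inferInstanceAs (AddCommGroup (Quiver.AnyPath V →₀ K))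

noncomputable instance : Module K (PathAlgebra K V) :=
  inferInstanceAs (Module K (Quiver.AnyPath V →₀ K))

/-- The basis of `KQ` that consists of the paths. -/
noncomputable def pathBasis (K : Type*) [Field K] (V : Type*) [Quiver V] :
    Module.Basis (Quiver.AnyPath V) K (PathAlgebra K V) :=
  Module.Basis.ofRepr (LinearEquiv.refl K (Quiver.AnyPath V →₀ K))

/-- The basis element of `KQ` given by a path `p` from `a` to `b`. -/
noncomputable def ofPath {a b : V} (p : Quiver.Path a b) : PathAlgebra K V :=
  pathBasis K V ⟨a, b, p⟩

open Classical in
/-- The product of two paths: first `p`, then `q`, and `0` if `q` does not start where `p` ends. -/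
noncomputable def mulPath (p q : Quiver.AnyPath V) : PathAlgebra K V :=
  if h : q.1 = p.2.1 then ofPath (p.2.2.comp (q.2.2.cast h rfl)) else 0

/-- The bilinear extension of the product of paths. -/
noncomputable def mulHom : PathAlgebra K V →ₗ[K] PathAlgebra K V →ₗ[K] PathAlgebra K V :=
  (pathBasis K V).constr K fun p => (pathBasis K V).constr K fun q => mulPath p q

noncomputable instance : Mul (PathAlgebra K V) := ⟨fun x y => mulHom x y⟩

/-- The unit of `KQ` is the sum of the trivial paths. -/
noncomputable instance [Fintype V] : One (PathAlgebra K V) :=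
  ⟨∑ v : V, ofPath (Quiver.Path.nil : Quiver.Path v v)⟩

theorem mul_def (x y : PathAlgebra K V) : x * y = mulHom x y := rfl

theorem one_def [Fintype V] :
    (1 : PathAlgebra K V) = ∑ v : V, ofPath (Quiver.Path.nil : Quiver.Path v v) := rfl

theorem mulHom_ofPath {a b c d : V} (p : Quiver.Path a b) (q : Quiver.Path c d) :
    mulHom (ofPath p : PathAlgebra K V) (ofPath q) = mulPath ⟨a, b, p⟩ ⟨c, d, q⟩ := by
  simp [mulHom, ofPath, Module.Basis.constr_basis]

theorem ofPath_mul_ofPath {a b c : V} (p : Quiver.Path a b) (q : Quiver.Path b c) :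
    (ofPath p * ofPath q : PathAlgebra K V) = ofPath (p.comp q) := by
  rw [mul_def, mulHom_ofPath]
  simp [mulPath]

theorem ofPath_mul_ofPath_of_ne {a b c d : V} (p : Quiver.Path a b) (q : Quiver.Path c d)
    (h : c ≠ b) : (ofPath p * ofPath q : PathAlgebra K V) = 0 := by
  rw [mul_def, mulHom_ofPath]
  simp [mulPath, h]

/-- To prove a statement that is preserved by linear combinations, it suffices to treat paths. -/
theorem induction_on {P : PathAlgebra K V → Prop} (x : PathAlgebra K V) (h0 : P 0)
    (hadd : ∀ x y, P x → P y → P (x + y)) (hsmul : ∀ (k : K) x, P x → P (k • x))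
    (hpath : ∀ (a b : V) (p : Quiver.Path a b), P (ofPath p)) : P x := by
  have hx : x ∈ Submodule.span K (Set.range (pathBasis K V)) := by
    rw [(pathBasis K V).span_eq]; trivial
  induction hx using Submodule.span_induction with
  | mem y hy => obtain ⟨⟨a, b, p⟩, rfl⟩ := hy; exact hpath a b p
  | zero => exact h0
  | add y z _ _ hy hz => exact hadd y z hy hz
  | smul k y _ hy => exact hsmul k y hy

theorem add_mul_aux (x y z : PathAlgebra K V) : (x + y) * z = x * z + y * z := by
  simp [mul_def]

theorem mul_add_aux (x y z : PathAlgebra K V) : x * (y + z) = x * y + x * z := by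
  simp [mul_def]

theorem smul_mul_aux (k : K) (x y : PathAlgebra K V) : (k • x) * y = k • (x * y) := by
  simp [mul_def]

theorem mul_smul_aux (k : K) (x y : PathAlgebra K V) : x * (k • y) = k • (x * y) := by
  simp [mul_def]

theorem zero_mul_aux (x : PathAlgebra K V) : 0 * x = 0 := by
  simp [mul_def]

theorem mul_zero_aux (x : PathAlgebra K V) : x * 0 = 0 := by
  simp [mul_def]

theorem mul_assoc_aux (x y z : PathAlgebra K V) : x * y * z = x * (y * z) := by
  induction x using induction_on with
  | h0 => simp [zero_mul_aux]
  | hadd x x' h h' => simp [add_mul_aux, h, h']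
  | hsmul k x h => simp [smul_mul_aux, h]
  | hpath a b p =>
    induction y using induction_on with
    | h0 => simp [zero_mul_aux, mul_zero_aux]
    | hadd x x' h h' => simp [add_mul_aux, mul_add_aux, h, h']
    | hsmul k x h => simp [smul_mul_aux, mul_smul_aux, h]
    | hpath c d q =>
      induction z using induction_on with
      | h0 => simp [mul_zero_aux]
      | hadd x x' h h' => simp [mul_add_aux, h, h']
      | hsmul k x h => simp [mul_smul_aux, h]
      | hpath e f r =>
        by_cases h1 : c = b
        · subst h1
          by_cases h2 : e = d
          · subst h2
            simp [ofPath_mul_ofPath]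
          · simp [ofPath_mul_ofPath, ofPath_mul_ofPath_of_ne, h2, mul_zero_aux]
        · by_cases h2 : e = d
          · subst h2
            simp [ofPath_mul_ofPath, ofPath_mul_ofPath_of_ne, h1, zero_mul_aux]
          · simp [ofPath_mul_ofPath_of_ne, h1, h2, zero_mul_aux, mul_zero_aux]

theorem one_mul_aux [Fintype V] (x : PathAlgebra K V) : 1 * x = x := by
  induction x using induction_on with
  | h0 => simp [mul_zero_aux]
  | hadd x x' h h' => simp [mul_add_aux, h, h']
  | hsmul k x h => simp [mul_smul_aux, h]
  | hpath a b p =>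
    have h : ∀ v : V, v ≠ a →
        (ofPath (Quiver.Path.nil : Quiver.Path v v) * ofPath p : PathAlgebra K V) = 0 :=
      fun v hv => ofPath_mul_ofPath_of_ne _ _ hv.symm
    have e : (1 * ofPath p : PathAlgebra K V) =
        ∑ v : V, ofPath (Quiver.Path.nil : Quiver.Path v v) * ofPath p := by
      simp [one_def, mul_def]
    rw [e, Fintype.sum_eq_single a h, ofPath_mul_ofPath]
    simp

theorem mul_one_aux [Fintype V] (x : PathAlgebra K V) : x * 1 = x := by
  induction x using induction_on with
  | h0 => simp [zero_mul_aux]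
  | hadd x x' h h' => simp [add_mul_aux, h, h']
  | hsmul k x h => simp [smul_mul_aux, h]
  | hpath a b p =>
    have h : ∀ v : V, v ≠ b →
        (ofPath p * ofPath (Quiver.Path.nil : Quiver.Path v v) : PathAlgebra K V) = 0 :=
      fun v hv => ofPath_mul_ofPath_of_ne _ _ hv
    have e : (ofPath p * 1 : PathAlgebra K V) =
        ∑ v : V, ofPath p * ofPath (Quiver.Path.nil : Quiver.Path v v) := by
      simp [one_def, mul_def]
    rw [e, Fintype.sum_eq_single b h, ofPath_mul_ofPath]
    simp

noncomputable instance [Fintype V] : Ring (PathAlgebra K V) :=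
  { (inferInstance : AddCommGroup (PathAlgebra K V)),
    (inferInstance : Mul (PathAlgebra K V)),
    (inferInstance : One (PathAlgebra K V)) with
    left_distrib := mul_add_aux
    right_distrib := add_mul_aux
    zero_mul := zero_mul_aux
    mul_zero := mul_zero_aux
    mul_assoc := mul_assoc_aux
    one_mul := one_mul_aux
    mul_one := mul_one_aux }

noncomputable instance [Fintype V] : Algebra K (PathAlgebra K V) :=
  Algebra.ofModule smul_mul_aux (fun k x y => mul_smul_aux k x y)

/-- The two-sided ideal `J` of `KQ` that is generated by the arrows. -/
noncomputable def arrowIdeal (K : Type*) [Field K] (V : Type*) [Quiver V] [Fintype V] :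
    Ideal (PathAlgebra K V) :=
  (TwoSidedIdeal.span
    {x | ∃ (a b : V) (e : a ⟶ b), x = (ofPath e.toPath : PathAlgebra K V)}).asIdeal

/-- A two-sided ideal `I` of `KQ` is admissible if `J ^ N ⊆ I ⊆ J ^ 2` for some `N ≥ 2`. -/
structure IsAdmissible [Fintype V] (I : Ideal (PathAlgebra K V)) : Prop where
  isTwoSided : I.IsTwoSided
  le_sq : I ≤ arrowIdeal K V ^ 2
  exists_pow_le : ∃ N : ℕ, 2 ≤ N ∧ arrowIdeal K V ^ N ≤ I

end PathAlgebra

end PathAlgebra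

/-! ### Symmetric algebras -/

/-- A symmetrizing form on a `K`-algebra `A`: a linear form `φ` with `φ (a * b) = φ (b * a)` whose
kernel contains no nonzero left ideal and no nonzero right ideal (right ideals are the submodules
over the opposite ring). -/
structure IsSymmetrizingForm {K A : Type*} [Field K] [Ring A] [Algebra K A]
    (φ : A →ₗ[K] K) : Prop where
  map_mul_comm : ∀ a b : A, φ (a * b) = φ (b * a)
  left_ideal : ∀ L : Submodule A A, (∀ x ∈ L, φ x = 0) → L = ⊥
  right_ideal : ∀ R : Submodule Aᵐᵒᵖ A, (∀ x ∈ R, φ x = 0) → R = ⊥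

/-- A symmetric algebra over a field `K`: a finite-dimensional algebra that has a symmetrizing
form. (This is unrelated to the symmetric algebra of a module.) -/
structure IsSymmetricFrobeniusAlgebra (K A : Type*) [Field K] [Ring A] [Algebra K A] : Prop where
  finite : Module.Finite K A
  exists_form : ∃ φ : A →ₗ[K] K, IsSymmetrizingForm φ

/-! ### Brauer configurations -/

/-- A Brauer configuration with vertex set `Γ₀` and with polygons labelled by the finite set `Γ₁`.
(That `Γ₀` is finite follows from `exists_polygon`.) -/
structure BrauerConfiguration (Γ₀ Γ₁ : Type*) [DecidableEq Γ₀] [Fintype Γ₁] where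
  /-- The multiset of vertices of the polygon with a given label. -/
  polygon : Γ₁ → Multiset Γ₀
  /-- The multiplicity function `μ`. -/
  mult : Γ₀ → ℕ
  mult_pos : ∀ α, 0 < mult α
  /-- The orientation, given by the successor map on the occurrences of a vertex `α` in polygons:
  the pair `⟨V, i⟩` stands for the `i`-th occurrence of `α` in `V`. -/
  succ : ∀ α : Γ₀, Equiv.Perm (Σ V : Γ₁, Fin ((polygon V).count α))
  /-- At each vertex the successor map is a cyclic ordering of all the occurrences. -/
  succ_isCycleOn : ∀ α : Γ₀, (succ α).IsCycleOn Set.univ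
  exists_polygon : ∀ α : Γ₀, ∃ V : Γ₁, α ∈ polygon V
  two_le_card : ∀ V : Γ₁, 2 ≤ (polygon V).card
  exists_nontruncated : ∀ V : Γ₁, ∃ α ∈ polygon V,
    1 < (∑ W : Γ₁, (polygon W).count α) * mult α

namespace BrauerConfiguration

variable {Γ₀ Γ₁ : Type*} [DecidableEq Γ₀] [Fintype Γ₁] (Γ : BrauerConfiguration Γ₀ Γ₁)

/-- `occ(α, V)`, the number of times `α` occurs as a vertex of `V`. -/
def occ (α : Γ₀) (V : Γ₁) : ℕ := (Γ.polygon V).count α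

/-- The valence of a vertex. -/
def val (α : Γ₀) : ℕ := ∑ V : Γ₁, Γ.occ α V

/-- A vertex `α` is truncated if `val(α) μ(α) = 1`. -/
def IsTruncated (α : Γ₀) : Prop := Γ.val α * Γ.mult α = 1

/-- The occurrences of the vertex `α` in polygons. -/
abbrev Occ (α : Γ₀) := Σ V : Γ₁, Fin ((Γ.polygon V).count α)

/-- All occurrences of nontruncated vertices in polygons. Such an occurrence `x` of `α` gives one
arrow of the quiver, and one special `α`-cycle. -/
structure NTOcc where
  vertex : Γ₀
  not_truncated : ¬ Γ.IsTruncated vertex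
  toOcc : Γ.Occ vertex

namespace NTOcc

variable {Γ}

/-- The polygon in which the occurrence takes place. -/
def poly (x : Γ.NTOcc) : Γ₁ := x.toOcc.1

/-- The next occurrence in the successor sequence at the vertex. -/
def next (x : Γ.NTOcc) : Γ.NTOcc := ⟨x.vertex, x.not_truncated, Γ.succ x.vertex x.toOcc⟩

theorem iterate_next (x : Γ.NTOcc) (n : ℕ) :
    next^[n] x = ⟨x.vertex, x.not_truncated, ((Γ.succ x.vertex) ^ n) x.toOcc⟩ := by
  induction n with
  | zero => rfl
  | succ n ih => rw [Function.iterate_succ_apply', ih, pow_succ', Equiv.Perm.mul_apply]; rfl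

/-- After `val(α)` steps the successor sequence at `α` is back where it started. -/
theorem iterate_next_val (x : Γ.NTOcc) : next^[Γ.val x.vertex] x = x := by
  have hc : (Finset.univ : Finset (Γ.Occ x.vertex)).card = Γ.val x.vertex := by
    simp [val, occ]
  have h : ((Γ.succ x.vertex) ^ (Γ.val x.vertex)) x.toOcc = x.toOcc := by
    rw [← hc]
    refine Equiv.Perm.IsCycleOn.pow_card_apply ?_ (Finset.mem_univ _)
    simpa using Γ.succ_isCycleOn x.vertex
  rw [iterate_next, h]

end NTOcc

/-- The vertex set of the quiver of `Γ`: one vertex for each polygon. -/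
def QuiverVertex (_Γ : BrauerConfiguration Γ₀ Γ₁) := Γ₁

instance : Fintype Γ.QuiverVertex := inferInstanceAs (Fintype Γ₁)

/-- The quiver of `Γ`: for each nontruncated vertex `α` and each occurrence of `α`, in `V` say, whose
successor at `α` is an occurrence in `V'`, there is one arrow from `V` to `V'`. -/
instance : Quiver Γ.QuiverVertex where
  Hom V W := {x : Γ.NTOcc // x.poly = V ∧ x.next.poly = W}

variable {Γ}

/-- The polygon of an occurrence as a vertex of the quiver. -/
def NTOcc.quiverVertex (x : Γ.NTOcc) : Γ.QuiverVertex := x.poly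

/-- The arrow that belongs to an occurrence and its successor. -/
def NTOcc.arrow (x : Γ.NTOcc) : x.quiverVertex ⟶ x.next.quiverVertex := ⟨x, rfl, rfl⟩

/-- The path of length `n` that follows the successor sequence at `α`, starting from the
occurrence `x` of `α`. -/
def NTOcc.walk : (n : ℕ) → (x : Γ.NTOcc) →
    Quiver.Path x.quiverVertex (NTOcc.next^[n] x).quiverVertex
  | 0, _ => Quiver.Path.nil
  | n + 1, x => x.arrow.toPath.comp (NTOcc.walk n x.next)

/-- The special `α`-cycle at the polygon of `x` that belongs to the occurrence `x` of `α`: it is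
`a_j a_{j+1} ⋯ a_{val(α)} a_1 ⋯ a_{j-1}` if `x` is the `j`-th term of the successor
sequence at `α`. Its first arrow is `x.arrow`. -/
def NTOcc.specialCycle (x : Γ.NTOcc) : Quiver.Path x.quiverVertex x.quiverVertex :=
  (x.walk (Γ.val x.vertex)).cast rfl (congrArg NTOcc.quiverVertex x.iterate_next_val)

open PathAlgebra

/-- The element `C ^ μ(α)` of `KQ`, where `C` is the special `α`-cycle of the occurrence `x`
of `α`. -/
noncomputable def NTOcc.cyclePow (K : Type*) [Field K] (x : Γ.NTOcc) :
    PathAlgebra K Γ.QuiverVertex :=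
  (ofPath x.specialCycle) ^ Γ.mult x.vertex

/-- `p` is a subpath of some special cycle. -/
def IsSubpathOfSpecialCycle {v w : Γ.QuiverVertex} (p : Quiver.Path v w) : Prop :=
  ∃ (x : Γ.NTOcc) (r : Quiver.Path x.quiverVertex v) (s : Quiver.Path w x.quiverVertex),
    x.specialCycle = (r.comp p).comp s

variable (K : Type*) [Field K] (Γ)

/-- Relations of type one: `C ^ μ(α) - C' ^ μ(β)` for a special `α`-cycle `C` and a special
`β`-cycle `C'` at the same polygon. -/
def relationsOne : Set (PathAlgebra K Γ.QuiverVertex) :=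
  {r | ∃ x y : Γ.NTOcc, x.poly = y.poly ∧ r = x.cyclePow K - y.cyclePow K}

/-- Relations of type two: `C ^ μ(α) a` for a special `α`-cycle `C` with first arrow `a`. -/
def relationsTwo : Set (PathAlgebra K Γ.QuiverVertex) :=
  {r | ∃ x : Γ.NTOcc, r = x.cyclePow K * ofPath x.arrow.toPath}

/-- Relations of type three: the paths `ab` of length two that are not subpaths of special cycles,
except those with `a = b` a loop at a vertex of valence `1` and multiplicity greater than `1`. -/
def relationsThree : Set (PathAlgebra K Γ.QuiverVertex) :=
  {r | ∃ (u v w : Γ.QuiverVertex) (a : u ⟶ v) (b : v ⟶ w),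
    ¬ IsSubpathOfSpecialCycle (a.toPath.comp b.toPath) ∧
    ¬ (a.1 = b.1 ∧ Γ.val a.1.vertex = 1 ∧ 1 < Γ.mult a.1.vertex) ∧
    r = ofPath (a.toPath.comp b.toPath)}

/-- The ideal of relations `I_Γ`, the two-sided ideal generated by the relations of the three
types. -/
noncomputable abbrev relationIdeal : Ideal (PathAlgebra K Γ.QuiverVertex) :=
  (TwoSidedIdeal.span
    (Γ.relationsOne K ∪ Γ.relationsTwo K ∪ Γ.relationsThree K)).asIdeal

/-- The Brauer configuration algebra `Λ_Γ = KQ_Γ / I_Γ`. -/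
abbrev BrauerAlgebra := PathAlgebra K Γ.QuiverVertex ⧸ Γ.relationIdeal K

end BrauerConfiguration

/-! Record a path by the list of occurrences that label its arrows. The paths `C ^ μ(α)` become the
lists running once through a full period of `next`, and compatibility with the relations can be
checked on lists.

Let φ be 1 on these paths and 0 on all others. Since a full period can be rotated, φ(xy) = φ(yx). It
vanishes on `I_Γ` because it vanishes on p r q for every relation r and all paths p, q
(`relations_subset_ker`). On the other side, modulo `I_Γ` every path is zero, trivial, or a walk
along a successor sequence of length at most its period (`ofPath_mem_or`), and all walks of full
period at one polygon agree.

Thus the trivial paths, one full cycle per polygon and the shorter nontrivial walks span the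
quotient. Each has a partner completing it to a full cycle, and φ pairs these two finite families by
the identity matrix. Hence every x is congruent modulo `I_Γ` to the sum of φ(d_i x) b_i
(`sub_sum_mem_relationIdeal`). This one expansion gives finite dimension and shows that x lies in
`I_Γ` as soon as φ(yx) = 0 for all y, so the induced form is nondegenerate.

For admissibility, periods are at least 2, which puts the relations in `J ^ 2`, and the bound on the
lengths of surviving paths puts a power of `J` in `I_Γ`. -/

namespace BrauerConfiguration

variable {Γ₀ Γ₁ : Type*} [DecidableEq Γ₀] [Fintype Γ₁] {Γ : BrauerConfiguration Γ₀ Γ₁}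

open PathAlgebra

/-! ### Periodicity of successor sequences -/

namespace NTOcc

/-- The length of the path `C ^ μ(α)`, where `C` is the special `α`-cycle of the occurrence `x`
of `α`. -/
def period (x : Γ.NTOcc) : ℕ := Γ.val x.vertex * Γ.mult x.vertex

theorem val_pos (x : Γ.NTOcc) : 0 < Γ.val x.vertex := by
  obtain ⟨V, hV⟩ := Γ.exists_polygon x.vertex
  exact (Multiset.count_pos.2 hV).trans_le
    (Finset.single_le_sum (f := fun W => Γ.occ x.vertex W) (fun _ _ => Nat.zero_le _)
      (Finset.mem_univ V))

theorem two_le_period (x : Γ.NTOcc) : 2 ≤ x.period := by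
  have h1 : 0 < x.period := Nat.mul_pos x.val_pos (Γ.mult_pos _)
  have h2 : x.period ≠ 1 := x.not_truncated
  omega

theorem vertex_iterate_next (x : Γ.NTOcc) (n : ℕ) : (next^[n] x).vertex = x.vertex := by
  rw [iterate_next]

theorem period_iterate_next (x : Γ.NTOcc) (n : ℕ) : (next^[n] x).period = x.period := by
  rw [iterate_next]; rfl

theorem iterate_next_val_mul (x : Γ.NTOcc) (m : ℕ) : next^[Γ.val x.vertex * m] x = x := by
  induction m with
  | zero => rfl
  | succ m ih => rw [Nat.mul_succ, Function.iterate_add_apply, iterate_next_val, ih]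

theorem iterate_next_period (x : Γ.NTOcc) : next^[x.period] x = x :=
  iterate_next_val_mul x _

theorem vertex_eq_of_mem_iterate {x y : Γ.NTOcc} {n : ℕ} (h : y ∈ List.iterate next x n) :
    y.vertex = x.vertex := by
  obtain ⟨m, -, rfl⟩ := List.mem_iterate.1 h
  exact x.vertex_iterate_next m

theorem next_eq_of_iterate_eq_append {x a b : Γ.NTOcc} {n : ℕ} {l₁ l₂ : List Γ.NTOcc}
    (h : List.iterate next x n = l₁ ++ a :: b :: l₂) : a.next = b := by
  have h₁ : (List.iterate next x n)[l₁.length]? = some a := by simp [h]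
  have h₂ : (List.iterate next x n)[l₁.length + 1]? = some b := by
    rw [h, List.getElem?_append_right (by omega)]; simp
  have hn : n = l₁.length + (l₂.length + 1 + 1) := by simpa using congrArg List.length h
  rw [List.getElem?_iterate _ _ _ _ (by omega), Option.some_inj] at h₁ h₂
  rw [← h₂, Function.iterate_succ_apply', h₁]

end NTOcc

/-! ### Cycle powers as lists of occurrences -/

/-- A list of occurrences is a cycle power if it lists the arrows of a path `C ^ μ(α)`. -/
def IsCyclePower (l : List Γ.NTOcc) : Prop :=
  ∃ x : Γ.NTOcc, l = List.iterate NTOcc.next x x.period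

open NTOcc

/-- Since `next` returns to its start after a full period, moving an initial segment to the end only
changes the starting occurrence. This is the source of the symmetry of the form. -/
theorem isCyclePower_append_comm {l₁ l₂ : List Γ.NTOcc} (h : IsCyclePower (l₁ ++ l₂)) :
    IsCyclePower (l₂ ++ l₁) := by
  obtain ⟨x, hx⟩ := h
  have hn : l₁.length + l₂.length = x.period := by simpa using congrArg List.length hx
  rw [← hn, List.iterate_add] at hx
  obtain ⟨h₁, h₂⟩ := List.append_inj hx (by simp)
  refine ⟨next^[l₁.length] x, ?_⟩
  have hx' : next^[l₂.length] (next^[l₁.length] x) = x := by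
    rw [← Function.iterate_add_apply, add_comm, hn, iterate_next_period]
  rw [period_iterate_next, ← hn, add_comm, List.iterate_add, hx', ← h₁, ← h₂]

/-- All occurrences in a cycle power belong to one vertex, hence have one period. A cycle power
inside another therefore already has its full length. -/
theorem eq_nil_of_isCyclePower_append {x : Γ.NTOcc} {l₁ l₂ : List Γ.NTOcc}
    (h : IsCyclePower (l₁ ++ List.iterate next x x.period ++ l₂)) : l₁ = [] ∧ l₂ = [] := by
  obtain ⟨y, hy⟩ := h
  have hx : x ∈ List.iterate next y y.period := by
    rw [← hy]
    have : x ∈ List.iterate next x x.period :=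
      List.mem_iterate.2 ⟨0, by have := x.two_le_period; omega, rfl⟩
    simp [this]
  have hp : x.period = y.period := by
    rw [period, period, vertex_eq_of_mem_iterate hx]
  have hl := congrArg List.length hy
  simp only [List.length_append, List.length_iterate] at hl
  exact ⟨List.length_eq_zero_iff.1 (by omega), List.length_eq_zero_iff.1 (by omega)⟩

theorem isCyclePower_iterate_iff {x : Γ.NTOcc} {n : ℕ} :
    IsCyclePower (List.iterate next x n) ↔ n = x.period := by
  constructor
  · rintro ⟨y, hy⟩
    have hn : n = y.period := by simpa using congrArg List.length hy
    have hx : x ∈ List.iterate next x n :=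
      List.mem_iterate.2 ⟨0, by have := y.two_le_period; omega, rfl⟩
    rw [hy] at hx
    rw [hn, period, period, vertex_eq_of_mem_iterate hx]
  · rintro rfl
    exact ⟨x, rfl⟩

/-! ### Paths and their lists of arrows -/

/-- The list of the occurrences that belong to the arrows of a path. -/
def arrows {v : Γ.QuiverVertex} : ∀ {w : Γ.QuiverVertex}, Quiver.Path v w → List Γ.NTOcc
  | _, .nil => []
  | _, .cons p e => arrows p ++ [e.1]

@[simp] theorem arrows_nil (v : Γ.QuiverVertex) :
    arrows (Quiver.Path.nil : Quiver.Path v v) = [] := rfl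

@[simp] theorem arrows_cons {u v w : Γ.QuiverVertex} (p : Quiver.Path u v) (e : v ⟶ w) :
    arrows (p.cons e) = arrows p ++ [e.1] := rfl

@[simp] theorem arrows_toPath {v w : Γ.QuiverVertex} (e : v ⟶ w) : arrows e.toPath = [e.1] := rfl

@[simp] theorem arrows_comp {u v w : Γ.QuiverVertex} (p : Quiver.Path u v) (q : Quiver.Path v w) :
    arrows (p.comp q) = arrows p ++ arrows q := by
  induction q with
  | nil => simp
  | cons q e ih => simp [ih]

@[simp] theorem arrows_cast {u v u' v' : Γ.QuiverVertex} (hu : u = u') (hv : v = v')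
    (p : Quiver.Path u v) : arrows (p.cast hu hv) = arrows p := by
  subst hu hv; rfl

@[simp] theorem length_arrows {v w : Γ.QuiverVertex} (p : Quiver.Path v w) :
    (arrows p).length = p.length := by
  induction p with
  | nil => rfl
  | cons p e ih => simp [ih]

@[simp] theorem arrows_walk (n : ℕ) (x : Γ.NTOcc) : arrows (x.walk n) = List.iterate next x n := by
  induction n generalizing x with
  | zero => rfl
  | succ n ih => simp [walk, ih, List.iterate, arrow]

@[simp] theorem arrows_specialCycle (x : Γ.NTOcc) :
    arrows x.specialCycle = List.iterate next x (Γ.val x.vertex) := by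
  simp [specialCycle]

theorem quiverVertex_eq_of_arrows_eq_cons {v w : Γ.QuiverVertex} {p : Quiver.Path v w}
    {x : Γ.NTOcc} {l : List Γ.NTOcc} (h : arrows p = x :: l) : x.quiverVertex = v := by
  induction p generalizing l with
  | nil => simp at h
  | cons p e ih =>
    cases hp : arrows p with
    | nil =>
      rw [arrows_cons, hp] at h
      obtain rfl : e.1 = x := by simpa using (List.cons.inj h).1
      cases p with
      | nil => exact e.2.1
      | cons p f => simp at hp
    | cons y l' =>
      rw [arrows_cons, hp] at h
      obtain rfl : y = x := (List.cons.inj h).1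
      exact ih hp

/-- The source has to be given because all trivial paths have the empty list; the target is then
determined by the last arrow. Packing the endpoints into `AnyPath` allows targets that are not known
to agree in advance. -/
theorem anyPath_eq {v w v' w' : Γ.QuiverVertex} (p : Quiver.Path v w) (q : Quiver.Path v' w')
    (hv : v = v') (h : arrows p = arrows q) :
    (⟨v, w, p⟩ : Quiver.AnyPath Γ.QuiverVertex) = ⟨v', w', q⟩ := by
  induction p generalizing w' with
  | nil =>
    cases q with
    | nil => subst hv; rfl
    | cons q e => simp at h
  | cons p e ih =>
    cases q with
    | nil => simp at h
    | cons q f =>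
      obtain ⟨h₁, h₂⟩ := List.append_inj' h rfl
      cases ih q h₁
      obtain ⟨x, hx, rfl⟩ := e
      obtain ⟨y, hy, rfl⟩ := f
      obtain rfl : x = y := by simpa using h₂
      rfl

theorem path_eq_of_arrows_eq {v w : Γ.QuiverVertex} {p q : Quiver.Path v w}
    (h : arrows p = arrows q) : p = q := by
  have := anyPath_eq p q rfl h
  simpa using this

theorem anyPath_eq_of_arrows_eq_iterate {v w : Γ.QuiverVertex} {p : Quiver.Path v w}
    {x : Γ.NTOcc} {n : ℕ} (hn : 0 < n) (h : arrows p = List.iterate next x n) :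
    (⟨v, w, p⟩ : Quiver.AnyPath Γ.QuiverVertex) = ⟨_, _, x.walk n⟩ := by
  obtain ⟨n, rfl⟩ := Nat.exists_eq_succ_of_ne_zero hn.ne'
  exact anyPath_eq _ _ (quiverVertex_eq_of_arrows_eq_cons h).symm (by rw [h, arrows_walk])

theorem next_eq_of_val_eq_one {x : Γ.NTOcc} (h : Γ.val x.vertex = 1) : x.next = x := by
  simpa [h] using x.iterate_next_val

/-- A path of length two is a relation of type three if and only if its arrows do not follow each
other in a successor sequence. -/
theorem isSubpath_or_loop_iff {u v w : Γ.QuiverVertex} (a : u ⟶ v) (b : v ⟶ w) :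
    (IsSubpathOfSpecialCycle (a.toPath.comp b.toPath) ∨
      (a.1 = b.1 ∧ Γ.val a.1.vertex = 1 ∧ 1 < Γ.mult a.1.vertex)) ↔ a.1.next = b.1 := by
  constructor
  · rintro (⟨x, r, s, h⟩ | ⟨h, hv, -⟩)
    · have := congrArg arrows h
      simp only [arrows_specialCycle, arrows_comp, arrows_toPath, List.append_assoc,
        List.cons_append, List.nil_append] at this
      exact next_eq_of_iterate_eq_append this
    · rw [next_eq_of_val_eq_one hv, h]
  · intro h
    obtain ⟨x, rfl, rfl⟩ := a
    obtain ⟨y, hy, rfl⟩ := b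
    dsimp only at h
    subst h
    -- At valence 1 the special cycle is a single loop, too short to contain a path of length two.
    -- This is the exceptional case of type three, and `μ > 1` holds there because the vertex is not
    -- truncated.
    by_cases hv : Γ.val x.vertex = 1
    · refine Or.inr ⟨(next_eq_of_val_eq_one hv).symm, hv, ?_⟩
      have := x.two_le_period
      rw [period] at this
      dsimp only
      rw [hv] at this
      omega
    -- Now the special cycle starting at `x` begins with the two given arrows, followed by `n` more.
    · obtain ⟨n, hn⟩ : ∃ n, Γ.val x.vertex = n + 2 :=
        ⟨Γ.val x.vertex - 2, by have := x.val_pos; omega⟩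
      have hx : (next^[n] x.next.next).quiverVertex = x.quiverVertex := by
        have := x.iterate_next_val
        rw [hn] at this
        exact congrArg quiverVertex this
      refine Or.inl ⟨x, Quiver.Path.nil, (x.next.next.walk n).cast rfl hx, ?_⟩
      apply path_eq_of_arrows_eq
      erw [arrows_specialCycle, arrows_comp, arrows_comp, arrows_comp, arrows_cast, arrows_walk]
      rw [hn]
      rfl

end BrauerConfiguration

/-! ### Paths and walks as elements of the path algebra -/

namespace PathAlgebra

variable {K : Type*} [Field K] {V : Type*} [Quiver V]

theorem ofPath_eq_ofPath_iff {a b c d : V} {p : Quiver.Path a b} {q : Quiver.Path c d} :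
    (ofPath p : PathAlgebra K V) = ofPath q ↔
      (⟨a, b, p⟩ : Quiver.AnyPath V) = ⟨c, d, q⟩ :=
  (pathBasis K V).injective.eq_iff

theorem mem_of_forall_ofPath_mem {S : Submodule K (PathAlgebra K V)} {x : PathAlgebra K V}
    (h : ∀ (a b : V) (p : Quiver.Path a b), ofPath p ∈ S) : x ∈ S :=
  induction_on x S.zero_mem (fun _ _ => S.add_mem) (fun k _ => S.smul_mem k) h

end PathAlgebra

namespace BrauerConfiguration

variable {Γ₀ Γ₁ : Type*} [DecidableEq Γ₀] [Fintype Γ₁] {Γ : BrauerConfiguration Γ₀ Γ₁}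
  {K : Type*} [Field K]

open PathAlgebra NTOcc

variable (K) in
/-- The path of length `n` along the successor sequence from `x`, as an element of `KQ`. -/
noncomputable def walkElem (x : Γ.NTOcc) (n : ℕ) : PathAlgebra K Γ.QuiverVertex :=
  ofPath (x.walk n)

variable (K) in
/-- The trivial path at `v`, as an element of `KQ`. -/
noncomputable def idem (v : Γ.QuiverVertex) : PathAlgebra K Γ.QuiverVertex :=
  ofPath (Quiver.Path.nil : Quiver.Path v v)

theorem ofPath_eq_walkElem {v w : Γ.QuiverVertex} {p : Quiver.Path v w} {x : Γ.NTOcc} {n : ℕ}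
    (hn : 0 < n) (h : arrows p = List.iterate next x n) : ofPath p = walkElem K x n :=
  ofPath_eq_ofPath_iff.2 (anyPath_eq_of_arrows_eq_iterate hn h)

theorem walkElem_mul_walkElem {x y : Γ.NTOcc} {n : ℕ} (h : next^[n] x = y) (m : ℕ) :
    walkElem K x n * walkElem K y m = walkElem K x (n + m) := by
  subst h
  rw [walkElem, walkElem, ofPath_mul_ofPath]
  exact ofPath_eq_ofPath_iff.2 (anyPath_eq _ _ rfl (by simp [List.iterate_add]))

theorem walkElem_one (x : Γ.NTOcc) : walkElem K x 1 = ofPath x.arrow.toPath :=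
  ofPath_eq_ofPath_iff.2 (anyPath_eq _ _ rfl (by rw [arrows_walk]; rfl))

theorem cyclePow_eq_walkElem (x : Γ.NTOcc) : x.cyclePow K = walkElem K x x.period := by
  have h1 : (ofPath x.specialCycle : PathAlgebra K Γ.QuiverVertex) =
      walkElem K x (Γ.val x.vertex) :=
    ofPath_eq_walkElem x.val_pos (arrows_specialCycle x)
  have h : ∀ m, (ofPath x.specialCycle : PathAlgebra K Γ.QuiverVertex) ^ (m + 1) =
      walkElem K x (Γ.val x.vertex * (m + 1)) := by
    intro m
    induction m with
    | zero => simpa using h1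
    | succ m ih =>
      rw [pow_succ, ih, h1, walkElem_mul_walkElem (x.iterate_next_val_mul _), Nat.mul_succ _ (m + 1)]
  obtain ⟨m, hm⟩ := Nat.exists_eq_succ_of_ne_zero (Γ.mult_pos x.vertex).ne'
  rw [cyclePow, period, hm, h]

/-! ### The linear form and its symmetry -/

open Classical in
variable (Γ K) in
/-- The linear form on `KQ` that is `1` on the paths `C ^ μ(α)` and `0` on all other paths. -/
noncomputable def pathForm : PathAlgebra K Γ.QuiverVertex →ₗ[K] K :=
  (pathBasis K Γ.QuiverVertex).constr K fun p => if IsCyclePower (arrows p.2.2) then 1 else 0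

open Classical in
theorem pathForm_ofPath {v w : Γ.QuiverVertex} (p : Quiver.Path v w) :
    Γ.pathForm K (ofPath p) = if IsCyclePower (arrows p) then 1 else 0 :=
  (pathBasis K Γ.QuiverVertex).constr_basis K _ _

open Classical in
theorem pathForm_ofPath_mul_ofPath {a b c d : Γ.QuiverVertex} (p : Quiver.Path a b)
    (q : Quiver.Path c d) : Γ.pathForm K (ofPath p * ofPath q) =
      if c = b ∧ IsCyclePower (arrows p ++ arrows q) then 1 else 0 := by
  by_cases h : c = b
  · subst h
    simp [ofPath_mul_ofPath, pathForm_ofPath]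
  · simp [ofPath_mul_ofPath_of_ne p q h, h]

theorem exists_cyclePower_iff {v w : Γ.QuiverVertex} (p : Quiver.Path v w) :
    (∃ x : Γ.NTOcc, ofPath p = x.cyclePow K) ↔ IsCyclePower (arrows p) := by
  refine exists_congr fun x => ?_
  rw [cyclePow_eq_walkElem]
  refine ⟨fun h => ?_, fun h => ofPath_eq_walkElem (by have := x.two_le_period; omega) h⟩
  have := congrArg (fun q : Quiver.AnyPath Γ.QuiverVertex => arrows q.2.2)
    (ofPath_eq_ofPath_iff.1 h)
  simpa using this

/-- Ensures that if `pq` is a cycle power, then `q` and `p` can also be composed in the opposite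
order. -/
theorem source_eq_target_of_isCyclePower {v w : Γ.QuiverVertex} {p : Quiver.Path v w}
    (h : IsCyclePower (arrows p)) : v = w := by
  obtain ⟨x, hx⟩ := h
  have := anyPath_eq_of_arrows_eq_iterate (by have := x.two_le_period; omega) hx
  have hv : v = x.quiverVertex := congrArg (·.1) this
  have hw : w = (next^[x.period] x).quiverVertex := congrArg (·.2.1) this
  rw [hv, hw, iterate_next_period]

theorem pathForm_mul_comm (x y : PathAlgebra K Γ.QuiverVertex) :
    Γ.pathForm K (x * y) = Γ.pathForm K (y * x) := by
  classical
  have key : ∀ {a b c d : Γ.QuiverVertex} (p : Quiver.Path a b) (q : Quiver.Path c d),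
      c = b ∧ IsCyclePower (arrows p ++ arrows q) → a = d ∧ IsCyclePower (arrows q ++ arrows p) := by
    rintro a b c d p q ⟨rfl, h⟩
    exact ⟨source_eq_target_of_isCyclePower (p := p.comp q) (by simpa using h),
      isCyclePower_append_comm h⟩
  induction x using induction_on with
  | h0 => simp
  | hadd x x' h h' => simp [add_mul, mul_add, h, h']
  | hsmul k x h => rw [smul_mul_assoc, mul_smul_comm, map_smul, map_smul, h]
  | hpath a b p =>
    induction y using induction_on with
    | h0 => simp
    | hadd x x' h h' => simp [add_mul, mul_add, h, h']
    | hsmul k x h => rw [smul_mul_assoc, mul_smul_comm, map_smul, map_smul, h]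
    | hpath c d q =>
      rw [pathForm_ofPath_mul_ofPath, pathForm_ofPath_mul_ofPath]
      exact if_congr ⟨key p q, key q p⟩ rfl rfl

/-- Both lengths must be positive so that `x` and `y` can be read off as first entries of the two
lists. A walk of length zero remembers only the polygon. -/
theorem pathForm_walkElem_mul_walkElem [DecidableEq Γ.NTOcc] {x y : Γ.NTOcc} {n m : ℕ}
    (hn : 0 < n) (hm : 0 < m) : Γ.pathForm K (walkElem K x n * walkElem K y m) =
      if next^[n] x = y ∧ n + m = x.period then 1 else 0 := by
  classical
  rw [walkElem, walkElem, pathForm_ofPath_mul_ofPath, arrows_walk, arrows_walk]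
  refine if_congr ⟨?_, ?_⟩ rfl rfl
  · rintro ⟨-, z, hz⟩
    have hl : n + m = z.period := by simpa using congrArg List.length hz
    rw [← hl, List.iterate_add] at hz
    obtain ⟨h₁, h₂⟩ := List.append_inj hz (by simp)
    obtain ⟨n, rfl⟩ := Nat.exists_eq_succ_of_ne_zero hn.ne'
    obtain ⟨m, rfl⟩ := Nat.exists_eq_succ_of_ne_zero hm.ne'
    obtain rfl : x = z := (List.cons.inj h₁).1
    exact ⟨(List.cons.inj h₂).1.symm, hl⟩
  · rintro ⟨rfl, h⟩
    exact ⟨rfl, x, by rw [← h, List.iterate_add]⟩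

theorem pathForm_walkElem (x : Γ.NTOcc) (n : ℕ) :
    Γ.pathForm K (walkElem K x n) = if n = x.period then 1 else 0 := by
  classical
  rw [walkElem, pathForm_ofPath, arrows_walk]
  exact if_congr isCyclePower_iterate_iff rfl rfl

theorem idem_mul_idem (v : Γ.QuiverVertex) : idem K v * idem K v = idem K v :=
  ofPath_mul_ofPath _ _

theorem idem_mul_idem_of_ne {v w : Γ.QuiverVertex} (h : v ≠ w) : idem K v * idem K w = 0 :=
  ofPath_mul_ofPath_of_ne _ _ h.symm

theorem idem_mul_walkElem (x : Γ.NTOcc) (n : ℕ) :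
    idem K x.quiverVertex * walkElem K x n = walkElem K x n := by
  rw [idem, walkElem, ofPath_mul_ofPath, Quiver.Path.nil_comp]

theorem idem_mul_walkElem_of_ne {x : Γ.NTOcc} {v : Γ.QuiverVertex} (h : x.quiverVertex ≠ v)
    (n : ℕ) : idem K v * walkElem K x n = 0 :=
  ofPath_mul_ofPath_of_ne _ _ h

theorem pathForm_idem (v : Γ.QuiverVertex) : Γ.pathForm K (idem K v) = 0 := by
  classical
  rw [idem, pathForm_ofPath, if_neg]
  rintro ⟨x, hx⟩
  have := x.two_le_period
  have := congrArg List.length hx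
  simp only [arrows_nil, List.length_nil, List.length_iterate] at this
  omega

theorem pathForm_idem_mul_walkElem [DecidableEq Γ.QuiverVertex] (v : Γ.QuiverVertex) (x : Γ.NTOcc)
    (n : ℕ) : Γ.pathForm K (idem K v * walkElem K x n) =
      if x.quiverVertex = v ∧ n = x.period then 1 else 0 := by
  by_cases h : x.quiverVertex = v
  · subst h
    simp [idem_mul_walkElem, pathForm_walkElem]
  · simp [idem_mul_walkElem_of_ne h, h]

/-! ### The form vanishes on the relations -/

/-- The largest two-sided ideal on which a linear form vanishes. -/
def _root_.LinearMap.kerTwoSidedIdeal {A : Type*} [Ring A] [Algebra K A] (φ : A →ₗ[K] K) :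
    TwoSidedIdeal A :=
  TwoSidedIdeal.mk' {x | ∀ y z, φ (y * x * z) = 0} (by simp)
    (fun hx hy u v => by simp [mul_add, add_mul, hx u v, hy u v])
    (fun hx u v => by simp [hx u v])
    (fun {a x} hx u v => by simpa only [mul_assoc] using hx (u * a) v)
    (fun {x a} hx u v => by simpa only [mul_assoc] using hx u (a * v))

theorem mem_ker_of_forall_ofPath {x : PathAlgebra K Γ.QuiverVertex}
    (h : ∀ {a b c d : Γ.QuiverVertex} (p : Quiver.Path a b) (q : Quiver.Path c d),
      Γ.pathForm K (ofPath p * x * ofPath q) = 0) : x ∈ (Γ.pathForm K).kerTwoSidedIdeal := by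
  rw [LinearMap.kerTwoSidedIdeal, TwoSidedIdeal.mem_mk']
  intro y z
  induction y using induction_on with
  | h0 => simp
  | hadd y y' h h' => simp [add_mul, h, h']
  | hsmul k y h => rw [smul_mul_assoc, smul_mul_assoc, map_smul, h, smul_zero]
  | hpath a b p =>
    induction z using induction_on with
    | h0 => simp
    | hadd x x' h h' => simp [mul_add, h, h']
    | hsmul k x h => rw [mul_smul_comm, map_smul, h, smul_zero]
    | hpath c d q => exact h p q

open Classical in
theorem pathForm_mul_ofPath_mul {a b c d u v : Γ.QuiverVertex} (p : Quiver.Path a b)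
    (r : Quiver.Path u v) (q : Quiver.Path c d) :
    Γ.pathForm K (ofPath p * ofPath r * ofPath q) =
      if u = b ∧ c = v ∧ IsCyclePower (arrows p ++ arrows r ++ arrows q) then 1 else 0 := by
  by_cases h : u = b
  · subst h
    simp [ofPath_mul_ofPath, pathForm_ofPath_mul_ofPath]
  · simp [ofPath_mul_ofPath_of_ne p r h, h]

/-- Type one: the value on `p C^μ(α) q` depends only on the polygon of `C`, since it is nonzero
exactly when `p` and `q` are trivial there. Type two: a cycle power cannot properly contain another.
Type three: consecutive arrows of a cycle power are consecutive in a successor sequence. -/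
theorem relations_subset_ker :
    Γ.relationsOne K ∪ Γ.relationsTwo K ∪ Γ.relationsThree K ⊆
      ((Γ.pathForm K).kerTwoSidedIdeal : Set (PathAlgebra K Γ.QuiverVertex)) := by
  classical
  rintro _ ((⟨x, y, hxy, rfl⟩ | ⟨x, rfl⟩) | ⟨u, v, w, a, b, hs, hl, rfl⟩) <;>
    refine mem_ker_of_forall_ofPath fun {a' b' c' d'} p q => ?_
  · have key : ∀ z : Γ.NTOcc, Γ.pathForm K (ofPath p * z.cyclePow K * ofPath q) =
        if z.quiverVertex = b' ∧ c' = z.quiverVertex ∧ arrows p = [] ∧ arrows q = []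
          then 1 else 0 := by
      intro z
      rw [cyclePow_eq_walkElem, walkElem, pathForm_mul_ofPath_mul, arrows_walk,
        iterate_next_period]
      refine if_congr (and_congr_right' (and_congr_right' ⟨eq_nil_of_isCyclePower_append, ?_⟩))
        rfl rfl
      rintro ⟨hp, hq⟩
      rw [hp, hq]
      exact ⟨z, by simp⟩
    rw [mul_sub, sub_mul, map_sub, key, key, show x.quiverVertex = y.quiverVertex from hxy, sub_self]
  · rw [cyclePow_eq_walkElem, ← walkElem_one, walkElem_mul_walkElem x.iterate_next_period, walkElem,
      pathForm_mul_ofPath_mul, if_neg]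
    rintro ⟨-, -, h⟩
    -- Regroup so that the extra arrow is part of what follows the full cycle; that remainder would
    -- have to be empty.
    rw [arrows_walk, List.iterate_add, ← List.append_assoc, List.append_assoc] at h
    have := (eq_nil_of_isCyclePower_append h).2
    simp [List.iterate] at this
  · rw [pathForm_mul_ofPath_mul, if_neg]
    rintro ⟨-, -, x, hx⟩
    have := (isSubpath_or_loop_iff a b).2 (next_eq_of_iterate_eq_append
      (l₁ := arrows p) (l₂ := arrows q) (x := x) (n := x.period) (by simp [← hx]))
    tauto

theorem pathForm_eq_zero {x : PathAlgebra K Γ.QuiverVertex} (hx : x ∈ Γ.relationIdeal K) :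
    Γ.pathForm K x = 0 := by
  have h := TwoSidedIdeal.span_le.2 (relations_subset_ker (Γ := Γ) (K := K))
    (TwoSidedIdeal.mem_asIdeal.1 hx)
  rw [LinearMap.kerTwoSidedIdeal, TwoSidedIdeal.mem_mk'] at h
  simpa using h 1 1

end BrauerConfiguration

namespace BrauerConfiguration

variable {Γ₀ Γ₁ : Type*} [DecidableEq Γ₀] [Fintype Γ₁] {Γ : BrauerConfiguration Γ₀ Γ₁}
  {K : Type*} [Field K]

open PathAlgebra NTOcc

/-! ### Paths modulo the relations -/

theorem subset_relationIdeal {r : PathAlgebra K Γ.QuiverVertex}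
    (h : r ∈ Γ.relationsOne K ∪ Γ.relationsTwo K ∪ Γ.relationsThree K) : r ∈ Γ.relationIdeal K :=
  TwoSidedIdeal.mem_asIdeal.2 (TwoSidedIdeal.subset_span h)

/-- Append one arrow at a time to a walk. If it does not follow the last arrow in the successor
sequence, the two form a type three relation; if it does, the walk grows until its length exceeds
the period, where a type two relation appears. The surviving lengths `n + 1` include the full
period. -/
theorem ofPath_mem_or {v w : Γ.QuiverVertex} (p : Quiver.Path v w) :
    ofPath p ∈ Γ.relationIdeal K ∨ arrows p = [] ∨
      ∃ (x : Γ.NTOcc) (n : ℕ), n < x.period ∧ arrows p = List.iterate next x (n + 1) := by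
  induction p with
  | nil => exact Or.inr (Or.inl rfl)
  | @cons u w p e ih =>
    have hpe : (ofPath (p.cons e) : PathAlgebra K Γ.QuiverVertex) =
        ofPath p * ofPath e.toPath := (ofPath_mul_ofPath p e.toPath).symm
    rcases ih with h | h | ⟨x, n, hn, h⟩
    · exact Or.inl (hpe ▸ Ideal.mul_mem_right _ _ h)
    · refine Or.inr (Or.inr ⟨e.1, 0, by have := e.1.two_le_period; omega, ?_⟩)
      rw [arrows_cons, h]; rfl
    · cases p with
      | nil => simp [List.iterate] at h
      | cons p f =>
        have hi : List.iterate next x (n + 1) = List.iterate next x n ++ [next^[n] x] :=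
          List.iterate_add _ _ _ _
        have h' := h
        rw [arrows_cons, hi] at h'
        have hf : f.1 = next^[n] x := by simpa using (List.append_inj' h' rfl).2
        by_cases hfe : f.1.next = e.1
        · have he : e.1 = next^[n + 1] x := by
            rw [Function.iterate_succ_apply', ← hf, hfe]
          rcases Nat.lt_or_ge (n + 1) x.period with hlt | hge
          · refine Or.inr (Or.inr ⟨x, n + 1, hlt, ?_⟩)
            rw [arrows_cons, h, he, ← List.singleton_append, List.append_nil,
              List.iterate_add _ _ (n + 1) 1]
            rfl
          · left
            have hp : n + 1 = x.period := by omega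
            have : (ofPath ((p.cons f).cons e) : PathAlgebra K Γ.QuiverVertex) =
                x.cyclePow K * ofPath x.arrow.toPath := by
              rw [cyclePow_eq_walkElem, ← walkElem_one,
                walkElem_mul_walkElem x.iterate_next_period, ← hp]
              refine ofPath_eq_walkElem (by omega) ?_
              rw [arrows_cons, h, he, List.iterate_add _ _ (n + 1) 1]
              rfl
            rw [this]
            exact subset_relationIdeal (Or.inl (Or.inr ⟨x, rfl⟩))
        · left
          have : (ofPath ((p.cons f).cons e) : PathAlgebra K Γ.QuiverVertex) =
              ofPath p * ofPath (f.toPath.comp e.toPath) := by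
            rw [ofPath_mul_ofPath]; rfl
          rw [this]
          refine Ideal.mul_mem_left _ _ (subset_relationIdeal (Or.inr ⟨_, _, _, f, e, ?_, ?_, rfl⟩))
          · exact fun hs => hfe ((isSubpath_or_loop_iff f e).1 (Or.inl hs))
          · exact fun hs => hfe ((isSubpath_or_loop_iff f e).1 (Or.inr hs))

/-! ### Dual families for the form -/

theorem finite_vertex (Γ : BrauerConfiguration Γ₀ Γ₁) : Finite Γ₀ := by
  have h : (Finset.univ.biUnion fun V : Γ₁ => (Γ.polygon V).toFinset : Finset Γ₀) =
      (Set.univ : Set Γ₀) := by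
    ext α
    simpa using Γ.exists_polygon α
  exact Set.finite_univ_iff.1 (h ▸ Finset.finite_toSet _)

instance : Finite Γ.NTOcc := by
  have := Γ.finite_vertex
  refine Finite.of_injective (β := Σ α : Γ₀, Γ.Occ α) (fun x => ⟨x.vertex, x.toOcc⟩) ?_
  rintro ⟨α, h, x⟩ ⟨β, h', y⟩ hxy
  obtain ⟨rfl, hxy⟩ := Sigma.mk.inj_iff.1 hxy
  obtain rfl := eq_of_heq hxy
  rfl

theorem exists_occ (v : Γ.QuiverVertex) : ∃ x : Γ.NTOcc, x.quiverVertex = v := by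
  obtain ⟨α, hα, h⟩ := Γ.exists_nontruncated v
  exact ⟨⟨α, h.ne', v, ⟨0, Multiset.count_pos.2 hα⟩⟩, rfl⟩

/-- A nontruncated occurrence of a vertex in a given polygon. -/
noncomputable def someOcc (v : Γ.QuiverVertex) : Γ.NTOcc := (exists_occ v).choose

@[simp] theorem quiverVertex_someOcc (v : Γ.QuiverVertex) : (someOcc v).quiverVertex = v :=
  (exists_occ v).choose_spec

variable (K) in
/-- A path `C ^ μ(α)` at the vertex `v` of the quiver. -/
noncomputable def socleElem (v : Γ.QuiverVertex) : PathAlgebra K Γ.QuiverVertex :=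
  walkElem K (someOcc v) (someOcc v).period

/-- Labels for a basis of the Brauer configuration algebra: the trivial paths, the socle elements
and the nontrivial proper initial subpaths of the paths `C ^ μ(α)`. -/
abbrev BasisIndex (Γ : BrauerConfiguration Γ₀ Γ₁) : Type _ :=
  Γ.QuiverVertex ⊕ Γ.QuiverVertex ⊕ Σ x : Γ.NTOcc, Fin (x.period - 1)

/-- There are finitely many occurrences of nontruncated vertices. -/
@[reducible] noncomputable def fintypeNTOcc (Γ : BrauerConfiguration Γ₀ Γ₁) : Fintype Γ.NTOcc :=
  Fintype.ofFinite _

attribute [local instance] fintypeNTOcc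

variable (K) in
/-- Representatives of the basis elements of the Brauer configuration algebra. -/
noncomputable def basisElem : Γ.BasisIndex → PathAlgebra K Γ.QuiverVertex
  | .inl v => idem K v
  | .inr (.inl v) => socleElem K v
  | .inr (.inr x) => walkElem K x.1 (x.2 + 1)

variable (K) in
/-- Representatives of the elements of the dual basis with respect to the form. -/
noncomputable def dualElem : Γ.BasisIndex → PathAlgebra K Γ.QuiverVertex
  | .inl v => socleElem K v
  | .inr (.inl v) => idem K v
  | .inr (.inr x) => walkElem K (next^[x.2.1 + 1] x.1) (x.1.period - (x.2 + 1))

-- The dual of an initial segment of a full cycle is its complementary segment, so their product, in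
-- this order, is a rotation of that cycle; trivial paths and socle elements are dual at each
-- polygon. All other pairs fail on the length or on the endpoints.
open Classical in
theorem pathForm_dualElem_mul_basisElem (i j : Γ.BasisIndex) :
    Γ.pathForm K (dualElem K i * basisElem K j) = if i = j then 1 else 0 := by
  have hp : ∀ x : Γ.NTOcc, 0 < x.period := fun x => by have := x.two_le_period; omega
  rcases i with v | v | ⟨x, l, hl⟩ <;> rcases j with w | w | ⟨y, m, hm⟩ <;>
    simp only [dualElem, basisElem, socleElem]
  · rw [pathForm_mul_comm, pathForm_idem_mul_walkElem]
    simp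
  · rw [pathForm_walkElem_mul_walkElem (hp _) (hp _), if_neg, if_neg]
    · simp
    · have := hp (someOcc w)
      omega
  · rw [pathForm_walkElem_mul_walkElem (hp _) (by omega), if_neg, if_neg]
    · simp
    · omega
  · by_cases h : v = w
    · subst h
      simp [idem_mul_idem, pathForm_idem]
    · simp [idem_mul_idem_of_ne h]
  · rw [pathForm_idem_mul_walkElem]
    simp [eq_comm]
  · rw [pathForm_idem_mul_walkElem, if_neg, if_neg]
    · simp
    · omega
  · rw [pathForm_mul_comm, pathForm_idem_mul_walkElem, if_neg, if_neg]
    · simp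
    · rw [period_iterate_next]
      omega
  · rw [pathForm_walkElem_mul_walkElem (by omega) (hp _), if_neg, if_neg]
    · simp
    · rintro ⟨h₁, h₂⟩
      -- Matching endpoints force equal periods, and then the product is longer than one period.
      rw [← h₁, period_iterate_next, period_iterate_next] at h₂
      omega
  · rw [pathForm_walkElem_mul_walkElem (by omega) (by omega), ← Function.iterate_add_apply,
      Nat.sub_add_cancel (by omega), iterate_next_period, period_iterate_next]
    refine if_congr ⟨?_, ?_⟩ rfl rfl
    · rintro ⟨rfl, h⟩
      obtain rfl : l = m := by omega
      rfl
    · intro h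
      simp only [Sum.inr.injEq, Sigma.mk.injEq] at h
      obtain ⟨rfl, h⟩ := h
      have : l = m := by simpa using h
      exact ⟨rfl, by omega⟩

/-- The remainder map `T` kills each `basisElem` by duality and is the identity on `I_Γ`, where the
form vanishes. As every path is congruent modulo `I_Γ` to zero or to a `basisElem`, all of `KQ` is
sent into `I_Γ`. -/
theorem sub_sum_mem_relationIdeal (x : PathAlgebra K Γ.QuiverVertex) :
    x - ∑ i, Γ.pathForm K (dualElem K i * x) • basisElem K i ∈ Γ.relationIdeal K := by
  classical
  let T : PathAlgebra K Γ.QuiverVertex →ₗ[K] PathAlgebra K Γ.QuiverVertex :=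
    LinearMap.id - ∑ i : Γ.BasisIndex,
      (((Γ.pathForm K).comp (LinearMap.mulLeft K (dualElem K i))).smulRight (basisElem K i))
  have hT : ∀ y, T y = y - ∑ i, Γ.pathForm K (dualElem K i * y) • basisElem K i := by
    intro y; simp [T]
  have hb : ∀ j : Γ.BasisIndex, T (basisElem K j) = 0 := by
    intro j
    rw [hT, Finset.sum_eq_single j]
    · simp [pathForm_dualElem_mul_basisElem]
    · intro i _ hij
      simp [pathForm_dualElem_mul_basisElem, hij]
    · simp
  have hI : ∀ y ∈ Γ.relationIdeal K, T y ∈ Γ.relationIdeal K := by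
    intro y hy
    rw [hT, Finset.sum_eq_zero, sub_zero]
    · exact hy
    · intro i _
      rw [pathForm_eq_zero (Ideal.mul_mem_left _ _ hy), zero_smul]
  rw [← hT]
  refine mem_of_forall_ofPath_mem
    (S := ((Γ.relationIdeal K).restrictScalars K).comap T) fun v w p => ?_
  rw [Submodule.mem_comap, Submodule.restrictScalars_mem]
  rcases ofPath_mem_or (K := K) p with h | h | ⟨y, n, hn, h⟩
  · exact hI _ h
  · have : (ofPath p : PathAlgebra K Γ.QuiverVertex) = basisElem K (.inl v) :=
      ofPath_eq_ofPath_iff.2 (anyPath_eq _ _ rfl h)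
    rw [this, hb]
    exact zero_mem _
  · rw [ofPath_eq_walkElem (n := n + 1) (Nat.succ_pos n) h]
    by_cases hn' : n + 1 = y.period
    -- A type one relation replaces this full cycle by the one chosen at its polygon.
    · have hr : walkElem K y y.period - socleElem K y.quiverVertex ∈ Γ.relationIdeal K := by
        rw [socleElem, ← cyclePow_eq_walkElem, ← cyclePow_eq_walkElem]
        exact subset_relationIdeal
          (Or.inl (Or.inl ⟨y, _, (quiverVertex_someOcc y.quiverVertex).symm, rfl⟩))
      have := hI _ hr
      rw [map_sub, show socleElem K y.quiverVertex = basisElem K (.inr (.inl y.quiverVertex))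
        from rfl, hb, sub_zero] at this
      rwa [hn']
    · have : walkElem K y (n + 1) =
          basisElem K (.inr (.inr ⟨y, ⟨n, by omega⟩⟩)) := rfl
      rw [this, hb]
      exact zero_mem _

/-! ### Finite dimension and nondegeneracy -/

theorem mem_relationIdeal_of_forall {x : PathAlgebra K Γ.QuiverVertex}
    (h : ∀ y, Γ.pathForm K (y * x) = 0) : x ∈ Γ.relationIdeal K := by
  simpa [h] using sub_sum_mem_relationIdeal x

theorem finiteDimensional_brauerAlgebra : FiniteDimensional K (Γ.BrauerAlgebra K) := by
  refine Module.Finite.of_surjective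
    (Fintype.linearCombination K fun i => Ideal.Quotient.mk (Γ.relationIdeal K) (basisElem K i)) ?_
  intro z
  obtain ⟨x, rfl⟩ := Ideal.Quotient.mk_surjective z
  refine ⟨fun i => Γ.pathForm K (dualElem K i * x), ?_⟩
  have h := Ideal.Quotient.eq.2 (sub_sum_mem_relationIdeal x)
  rw [h, Fintype.linearCombination_apply, map_sum]
  rfl

variable (Γ K) in
/-- The linear form on the Brauer configuration algebra that is induced by `pathForm`. -/
noncomputable def brauerForm : Γ.BrauerAlgebra K →ₗ[K] K :=
  ((Γ.relationIdeal K).restrictScalars K).liftQ (Γ.pathForm K) fun _ hx => pathForm_eq_zero hx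

theorem brauerForm_mk (x : PathAlgebra K Γ.QuiverVertex) :
    Γ.brauerForm K (Ideal.Quotient.mk (Γ.relationIdeal K) x) = Γ.pathForm K x := rfl

theorem isSymmetrizingForm_brauerForm : IsSymmetrizingForm (Γ.brauerForm K) := by
  have comm : ∀ a b : Γ.BrauerAlgebra K, Γ.brauerForm K (a * b) = Γ.brauerForm K (b * a) := by
    intro a b
    obtain ⟨x, rfl⟩ := Ideal.Quotient.mk_surjective a
    obtain ⟨y, rfl⟩ := Ideal.Quotient.mk_surjective b
    rw [← map_mul, ← map_mul, brauerForm_mk, brauerForm_mk, pathForm_mul_comm]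
  have nondeg : ∀ a : Γ.BrauerAlgebra K, (∀ b, Γ.brauerForm K (b * a) = 0) → a = 0 := by
    intro a h
    obtain ⟨x, rfl⟩ := Ideal.Quotient.mk_surjective a
    refine Ideal.Quotient.eq_zero_iff_mem.2 (mem_relationIdeal_of_forall fun y => ?_)
    rw [← brauerForm_mk, map_mul, h]
  refine ⟨comm, fun L hL => ?_, fun R hR => ?_⟩
  · exact (Submodule.eq_bot_iff L).2 fun a ha => nondeg a fun b => hL _ (L.smul_mem b ha)
  -- Symmetry of the form reduces right ideals to the left-hand criterion.
  · refine (Submodule.eq_bot_iff R).2 fun a ha => nondeg a fun b => ?_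
    rw [comm]
    exact hR _ (R.smul_mem (MulOpposite.op b) ha)

end BrauerConfiguration

/-! ### Admissibility -/

namespace PathAlgebra

variable {K : Type*} [Field K] {V : Type*} [Quiver V] [Fintype V]

variable (K V) in
/-- The subspace of `KQ` spanned by the paths of length at least `n`. -/
noncomputable def lengthFiltration (n : ℕ) : Submodule K (PathAlgebra K V) :=
  Submodule.span K {x | ∃ (a b : V) (p : Quiver.Path a b), n ≤ p.length ∧ x = ofPath p}

theorem mul_mem_lengthFiltration {m n : ℕ} {x y : PathAlgebra K V}
    (hx : x ∈ lengthFiltration K V m) (hy : y ∈ lengthFiltration K V n) :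
    x * y ∈ lengthFiltration K V (m + n) := by
  have h := Submodule.mul_mem_mul hx hy
  rw [lengthFiltration, lengthFiltration, Submodule.span_mul_span] at h
  refine Submodule.span_le.2 ?_ h
  rintro _ ⟨_, ⟨a, b, p, hp, rfl⟩, _, ⟨c, d, q, hq, rfl⟩, rfl⟩
  by_cases hbc : c = b
  · subst hbc
    refine Submodule.subset_span ⟨a, d, p.comp q, ?_, ofPath_mul_ofPath p q⟩
    rw [Quiver.Path.length_comp]
    omega
  · simp [ofPath_mul_ofPath_of_ne p q hbc]

theorem mem_lengthFiltration_zero (x : PathAlgebra K V) : x ∈ lengthFiltration K V 0 :=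
  mem_of_forall_ofPath_mem fun a b p => Submodule.subset_span ⟨a, b, p, Nat.zero_le _, rfl⟩

theorem mem_lengthFiltration_one {x : PathAlgebra K V} (hx : x ∈ arrowIdeal K V) :
    x ∈ lengthFiltration K V 1 := by
  let F : TwoSidedIdeal (PathAlgebra K V) :=
    TwoSidedIdeal.mk' (lengthFiltration K V 1) (zero_mem _) (fun hx hy => add_mem hx hy)
      (fun hx => neg_mem hx)
      (fun {x y} hy => by
        simpa using mul_mem_lengthFiltration (mem_lengthFiltration_zero x) hy)
      (fun {x y} hx => by
        simpa using mul_mem_lengthFiltration hx (mem_lengthFiltration_zero y))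
  have h : TwoSidedIdeal.span
      {x | ∃ (a b : V) (e : a ⟶ b), x = (ofPath e.toPath : PathAlgebra K V)} ≤ F := by
    refine TwoSidedIdeal.span_le.2 ?_
    rintro _ ⟨a, b, e, rfl⟩
    exact (TwoSidedIdeal.mem_mk' _ _ _ _ _ _ _).2
      (Submodule.subset_span ⟨a, b, e.toPath, le_rfl, rfl⟩)
  exact (TwoSidedIdeal.mem_mk' _ _ _ _ _ _ _).1 (h (TwoSidedIdeal.mem_asIdeal.1 hx))

theorem mem_lengthFiltration_of_mem_pow {n : ℕ} {x : PathAlgebra K V}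
    (hx : x ∈ arrowIdeal K V ^ n) : x ∈ lengthFiltration K V n := by
  induction n generalizing x with
  | zero => exact mem_lengthFiltration_zero x
  | succ n ih =>
    rw [Submodule.pow_succ] at hx
    refine Submodule.smul_induction_on hx (fun r hr s hs => ?_) (fun _ _ => add_mem)
    exact mul_mem_lengthFiltration (ih hr) (mem_lengthFiltration_one hs)

theorem ofPath_toPath_mem_arrowIdeal {a b : V} (e : a ⟶ b) :
    ofPath e.toPath ∈ arrowIdeal K V :=
  TwoSidedIdeal.mem_asIdeal.2 (TwoSidedIdeal.subset_span ⟨a, b, e, rfl⟩)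

instance : (arrowIdeal K V).IsTwoSided := by
  unfold arrowIdeal; infer_instance

end PathAlgebra

namespace BrauerConfiguration

variable {Γ₀ Γ₁ : Type*} [DecidableEq Γ₀] [Fintype Γ₁] {Γ : BrauerConfiguration Γ₀ Γ₁}
  {K : Type*} [Field K]

open PathAlgebra NTOcc

attribute [local instance] fintypeNTOcc

theorem mul_mem_arrowIdeal_sq {x y : PathAlgebra K Γ.QuiverVertex}
    (hx : x ∈ arrowIdeal K Γ.QuiverVertex) (hy : y ∈ arrowIdeal K Γ.QuiverVertex) :
    x * y ∈ arrowIdeal K Γ.QuiverVertex ^ 2 := by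
  rw [Submodule.pow_succ, Submodule.pow_one]
  exact Submodule.smul_mem_smul hx hy

/-- The vertex is not truncated, so the period is at least 2 and two arrows can be split off. -/
theorem cyclePow_mem_arrowIdeal_sq (x : Γ.NTOcc) :
    x.cyclePow K ∈ arrowIdeal K Γ.QuiverVertex ^ 2 := by
  obtain ⟨n, hn⟩ := Nat.exists_eq_add_of_le x.two_le_period
  have h : x.cyclePow K = walkElem K x 1 * (walkElem K x.next 1 * walkElem K x.next.next n) := by
    rw [walkElem_mul_walkElem (x := x.next) (y := x.next.next) (n := 1) rfl,
      walkElem_mul_walkElem (y := x.next) (n := 1) rfl, cyclePow_eq_walkElem, hn,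
      ← add_assoc]
  rw [h, walkElem_one, walkElem_one]
  exact mul_mem_arrowIdeal_sq (ofPath_toPath_mem_arrowIdeal _)
    (Ideal.mul_mem_right _ _ (ofPath_toPath_mem_arrowIdeal _))

theorem isAdmissible_relationIdeal : IsAdmissible (Γ.relationIdeal K) where
  isTwoSided := inferInstance
  le_sq := by
    have h : TwoSidedIdeal.span (Γ.relationsOne K ∪ Γ.relationsTwo K ∪ Γ.relationsThree K) ≤
        (arrowIdeal K Γ.QuiverVertex ^ 2).toTwoSided := by
      refine TwoSidedIdeal.span_le.2 ?_
      rintro _ ((⟨x, y, -, rfl⟩ | ⟨x, rfl⟩) | ⟨u, v, w, a, b, -, -, rfl⟩) <;>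
        rw [SetLike.mem_coe, Ideal.mem_toTwoSided]
      · exact sub_mem (cyclePow_mem_arrowIdeal_sq x) (cyclePow_mem_arrowIdeal_sq y)
      · exact Ideal.mul_mem_right _ _ (cyclePow_mem_arrowIdeal_sq x)
      · rw [← ofPath_mul_ofPath]
        exact mul_mem_arrowIdeal_sq (ofPath_toPath_mem_arrowIdeal _)
          (ofPath_toPath_mem_arrowIdeal _)
    intro x hx
    exact Ideal.mem_toTwoSided.1 (h (TwoSidedIdeal.mem_asIdeal.1 hx))
  exists_pow_le := by
    -- A path outside `I_Γ` is no longer than the largest period; adding 2 exceeds this and also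
    -- secures `2 ≤ N` when there are no occurrences.
    refine ⟨Finset.univ.sup (period (Γ := Γ)) + 2, Nat.le_add_left _ _, fun x hx => ?_⟩
    have h : lengthFiltration K Γ.QuiverVertex (Finset.univ.sup (period (Γ := Γ)) + 2) ≤
        (Γ.relationIdeal K).restrictScalars K := by
      refine Submodule.span_le.2 ?_
      rintro _ ⟨a, b, p, hp, rfl⟩
      rw [← length_arrows] at hp
      rcases ofPath_mem_or (K := K) p with h | h | ⟨x, n, hn, h⟩
      · exact h
      · simp [h] at hp
      · rw [h, List.length_iterate] at hp
        have : x.period ≤ _ := Finset.le_sup (f := period (Γ := Γ)) (Finset.mem_univ x)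
        omega
    exact h (mem_lengthFiltration_of_mem_pow hx)

end BrauerConfiguration

open Classical in
theorem proposition3p2 {Γ₀ Γ₁ : Type*} [DecidableEq Γ₀] [Fintype Γ₁]
    (Γ : BrauerConfiguration Γ₀ Γ₁) (K : Type*) [Field K] :
    PathAlgebra.IsAdmissible (Γ.relationIdeal K) ∧
    FiniteDimensional K (Γ.BrauerAlgebra K) ∧
    IsSymmetricFrobeniusAlgebra K (Γ.BrauerAlgebra K) ∧
    ∃ φ : Γ.BrauerAlgebra K →ₗ[K] K, IsSymmetrizingForm φ ∧
      ∀ (v w : Γ.QuiverVertex) (p : Quiver.Path v w),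
        φ (Ideal.Quotient.mk (Γ.relationIdeal K) (PathAlgebra.ofPath p)) =
          if ∃ x : Γ.NTOcc, PathAlgebra.ofPath p = x.cyclePow K then 1 else 0 := by
  refine ⟨BrauerConfiguration.isAdmissible_relationIdeal,
    BrauerConfiguration.finiteDimensional_brauerAlgebra,
    ⟨BrauerConfiguration.finiteDimensional_brauerAlgebra, Γ.brauerForm K,
      BrauerConfiguration.isSymmetrizingForm_brauerForm⟩,
    Γ.brauerForm K, BrauerConfiguration.isSymmetrizingForm_brauerForm, fun v w p => ?_⟩
  rw [BrauerConfiguration.brauerForm_mk, BrauerConfiguration.pathForm_ofPath]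
  exact if_congr (BrauerConfiguration.exists_cyclePower_iff p).symm rfl rfl
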